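/- \textbf{Definitions.} For a semigroup $S$, $t\ge 1$, $x_1,\dots,x_t\in S$ and $z_1,z_2,\ldots\in S^1$, put $\lambda_{0,i}=x_i$ and $$\lambda_{n+1,i}=\lambda_{n,i}z_{n+1}\lambda_{n,i+1}z_{n+1}\cdots\lambda_{n,t}z_{n+1}\lambda_{n,1}z_{n+1}\cdots\lambda_{n,i-1}\qquad(1\le i\le t).$$ The semigroup $S$ is \emph{strongly Mal'cev nilpotent} if there is a positive integer $n$ such that $\lambda_{n,1}=\cdots=\lambda_{n,t}$ for all $t$, all $x_1,\dots,x_t\in S$ and all $z_1,\dots,z_n\in S^1$. Let $\mathsf{SMN}$ be the class of all finite strongly Mal'cev nilpotent semigroups. A \emph{pseudovariety} is a class of finite semigroups closed under subsemigroups, homomorphic images and finite direct products. A \emph{pseudoidentity} in $r$ variables is a formal equality $\pi=\rho$ between two elements of the free profinite semigroup on $r$ generators; a finite semigroup $S$ satisfies it if $\hat\varphi(\pi)=\hat\varphi(\rho)$ for every map $\varphi$ from the generators to $S$, where $\hat\varphi$ is the continuous homomorphism extending $\varphi$. A set of pseudoidentities \emph{defines} a class $\mathsf V$ of finite semigroups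 if $\mathsf V$ consists of exactly the finite semigroups that satisfy all of them. The \emph{rank} of $\mathsf V$ is the least $r$ such that $\mathsf V$ is defined by a set of pseudoidentities in at most $r$ variables each, and it is infinite if there is no such $r$; $\mathsf V$ is \emph{finitely based} if it is defined by a finite set of pseudoidentities. For a prime $p$ let $A_p=\{\alpha_1,\dots,\alpha_p\}$ and $B_p=\{\beta_1,\dots,\beta_p\}$ be disjoint sets of $p$ elements each, and let $\theta\notin A_p\cup B_p$. Reading indices modulo $p$, define for $1\le i\le p$ transformations of $A_p\cup B_p\cup\{\theta\}$, acting on the right: $X_{p,i}$ maps $\alpha_i$ to $\beta_i$ and every other point to $\theta$; $W_{p,i}$ maps $\beta_j$ to $\alpha_{j+i}$ for $1\le j\le p$ and every other point to $\theta$. Let $S_p=\langle X_{p,1},\dots,X_{p,p},W_{p,1},\dots,W_{p,p}\rangle$ be the semigroup of transformations that they generate. \textbf{Theorem.} The class $\mathsf{SMN}$ is a pseudovariety, it has infinite rank, and it is not finitely based. Moreover, for every prime $p$, the $2p$ generators $X_{p,i}, W_{p,i}$ of $S_p$ are pairwise distinct partial bijections (they fix $\theta$ and are injective on the points that they do not map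 to $\theta$), $S_p\notin\mathsf{SMN}$, and $\langle x_1,\dots,x_{2p-1}\rangle\in\mathsf{SMN}$ for all $x_1,\dots,x_{2p-1}\in S_p$. -/

import Mathlib

universe u

/-! ### Strongly Mal'cev nilpotent semigroups -/

/-- The sequence `λ_{n,i}(x₁, …, x_t; z₁, …, z_n)`:
`λ_{0,i} = x_i` and
`λ_{n+1,i} = λ_{n,i} z_{n+1} λ_{n,i+1} z_{n+1} ⋯ λ_{n,t} z_{n+1} λ_{n,1} z_{n+1} ⋯ λ_{n,i-1}`.
The letters `z₁, z₂, …` are `z 0, z 1, …`, and `λ_n` only uses the first `n` of them.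
The list of all `λ_{n,j}` is rotated so that it begins with `λ_{n,i}`, and `z_{n+1}` is put
between any two neighbours. -/
def strongLambda {M : Type u} [Monoid M] {t : ℕ} (x : Fin t → M) (z : ℕ → M) :
    ℕ → Fin t → M
  | 0, i => x i
  | n + 1, i =>
      (((List.ofFn (strongLambda x z n)).rotate (i : ℕ)).intersperse (z n)).prod

/-- `S` is strongly Mal'cev nilpotent: for some positive integer `n`, and for all `t`,
all `x₁, …, x_t ∈ S` and all `z₁, …, z_n ∈ S¹`, the elements
`λ_{n,1}, …, λ_{n,t}` are equal.

The products are taken in `WithOne S`, which is `S` with a new identity. If `S` already has an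
identity `e`, then the new identity and `e` multiply elements of `S` in the same way, so that it
does not matter whether `S¹` stands for `S` or for `WithOne S` in this case. -/
def IsStronglyMalcevNilpotent (S : Type u) [Semigroup S] : Prop :=
  ∃ n : ℕ, 0 < n ∧ ∀ (t : ℕ) (x : Fin t → S) (z : ℕ → WithOne S) (i j : Fin t),
    strongLambda (fun k => (x k : WithOne S)) z n i =
      strongLambda (fun k => (x k : WithOne S)) z n j

/-! ### Pseudovarieties -/

/-- A class of finite semigroups. -/
abbrev FiniteSemigroupClass : Type 1 :=
  ∀ (S : Type) [Semigroup S] [Finite S], Prop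

/-- The class of all finite strongly Mal'cev nilpotent semigroups. -/
def SMN : FiniteSemigroupClass := fun S _ _ => IsStronglyMalcevNilpotent S

/-- A pseudovariety of semigroups: a class of finite semigroups that is closed under
subsemigroups, homomorphic images and finite direct products. -/
structure IsPseudovariety (V : FiniteSemigroupClass) : Prop where
  subsemigroup : ∀ (S : Type) [Semigroup S] [Finite S] (T : Subsemigroup S), V S → V T
  image : ∀ (S T : Type) [Semigroup S] [Finite S] [Semigroup T] [Finite T] (f : S →ₙ* T),
    Function.Surjective f → V S → V T
  prod : ∀ (ι : Type) [Finite ι] (S : ι → Type) [∀ i, Semigroup (S i)] [∀ i, Finite (S i)],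
    (∀ i, V (S i)) → V (∀ i, S i)

/-! ### Pseudoidentities -/

/-- The congruences of finite index on the free semigroup on `A`. -/
abbrev FiniteIndexCon (A : Type u) : Type u :=
  {c : Con (FreeSemigroup A) // Finite c.Quotient}

/-- The free profinite semigroup on `A`, as the inverse limit of the finite quotients of the
free semigroup on `A`: its elements are the families of classes `π c ∈ A⁺/c`, one for each
congruence `c` of finite index, that are compatible with the projections `A⁺/c → A⁺/d`
for `c ≤ d`. -/
def freeProfiniteSemigroup (A : Type u) :
    Subsemigroup (∀ c : FiniteIndexCon A, c.1.Quotient) where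
  carrier := {π | ∀ c d : FiniteIndexCon A, c.1 ≤ d.1 →
    ∀ w : FreeSemigroup A, π c = (w : c.1.Quotient) → π d = (w : d.1.Quotient)}
  mul_mem' := by
    intro π ρ hπ hρ c d hcd w hw
    obtain ⟨u, hu⟩ := Quotient.exists_rep (π c)
    obtain ⟨v, hv⟩ := Quotient.exists_rep (ρ c)
    have hu' : π c = (u : c.1.Quotient) := hu.symm
    have hv' : ρ c = (v : c.1.Quotient) := hv.symm
    rw [Pi.mul_apply, hπ c d hcd u hu', hρ c d hcd v hv', ← Con.coe_mul]
    rw [Pi.mul_apply, hu', hv', ← Con.coe_mul] at hw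
    exact (Con.eq d.1).2 (hcd ((Con.eq c.1).1 hw))

/-- The kernel, of finite index, of the homomorphism from the free semigroup on `A` to the finite
semigroup `S` that extends `φ`. -/
def evalCon {A : Type u} {S : Type} [Semigroup S] [Finite S] (φ : A → S) : FiniteIndexCon A :=
  ⟨Con.ker (FreeSemigroup.lift φ),
    Finite.of_injective
      (fun q : (Con.ker (FreeSemigroup.lift φ)).Quotient =>
        Con.liftOn q (FreeSemigroup.lift φ) fun _ _ h => h)
      (by
        intro a b
        induction a, b using Con.induction_on₂ with
        | H x y => exact fun h => (Con.eq _).2 h)⟩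

/-- The value `φ̂(π)` of `π` under the continuous homomorphism from the free profinite semigroup
on `A` to the finite semigroup `S` that extends `φ : A → S`. -/
def evalProfinite {A : Type u} {S : Type} [Semigroup S] [Finite S] (φ : A → S)
    (π : freeProfiniteSemigroup A) : S :=
  Con.liftOn (π.1 (evalCon φ)) (FreeSemigroup.lift φ) fun _ _ h => h

/-- A pseudoidentity: a formal equality `lhs = rhs` between elements of the free profinite
semigroup on finitely many variables. -/
structure Pseudoidentity : Type where
  /-- the number of variables -/
  arity : ℕ
  /-- the left-hand side -/
  lhs : freeProfiniteSemigroup (Fin arity)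
  /-- the right-hand side -/
  rhs : freeProfiniteSemigroup (Fin arity)

/-- The finite semigroup `S` satisfies the pseudoidentity `e`. -/
def SatisfiesPseudoidentity (S : Type) [Semigroup S] [Finite S] (e : Pseudoidentity) : Prop :=
  ∀ φ : Fin e.arity → S, evalProfinite φ e.lhs = evalProfinite φ e.rhs

/-- `E` is a basis of pseudoidentities for `V`: the class `V` consists of exactly the finite
semigroups that satisfy all pseudoidentities in `E`. -/
def IsPseudoidentityBasis (E : Set Pseudoidentity) (V : FiniteSemigroupClass) : Prop :=
  ∀ (S : Type) [Semigroup S] [Finite S], V S ↔ ∀ e ∈ E, SatisfiesPseudoidentity S e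

/-- `V` is finitely based: it is defined by a finite set of pseudoidentities. -/
def IsFinitelyBased (V : FiniteSemigroupClass) : Prop :=
  ∃ E : Set Pseudoidentity, E.Finite ∧ IsPseudoidentityBasis E V

/-- The rank of `V`: the least `r` such that `V` is defined by a set of pseudoidentities in at
most `r` variables each, and `⊤` if there is no such `r`. -/
noncomputable def pseudovarietyRank (V : FiniteSemigroupClass) : ℕ∞ :=
  sInf {r : ℕ∞ | ∃ n : ℕ, r = n ∧
    ∃ E : Set Pseudoidentity, (∀ e ∈ E, e.arity ≤ n) ∧ IsPseudoidentityBasis E V}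

/-! ### The transformation semigroups `S_p` -/

/-- The set `A_p ∪ B_p ∪ {θ}`: with indices read modulo `p`, the point `α_i` is
`some (Sum.inl i)`, the point `β_i` is `some (Sum.inr i)`, and `θ` is `none`. -/
abbrev Points (p : ℕ) : Type := Option (ZMod p ⊕ ZMod p)

/-- The full transformation semigroup on `X`, where transformations act on the right:
`f * g` is "first `f`, then `g`". -/
abbrev FullTransf (X : Type u) : Type u := (Function.End X)ᵐᵒᵖ

/-- `X_{p,i} = (α_i, β_i, θ)`: it maps `α_i` to `β_i` and all other points to `θ`. -/
def genX (p : ℕ) (i : ZMod p) : FullTransf (Points p) :=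
  MulOpposite.op fun a => match a with
    | some (Sum.inl j) => if j = i then some (Sum.inr i) else none
    | some (Sum.inr _) => none
    | none => none

/-- `W_{p,i} = (β_1, α_{1+i}, θ) ⋯ (β_p, α_{p+i}, θ)`, with indices modulo `p`: it maps `β_j` to
`α_{j+i}` for all `j`, and all other points to `θ`. -/
def genW (p : ℕ) (i : ZMod p) : FullTransf (Points p) :=
  MulOpposite.op fun a => match a with
    | some (Sum.inl _) => none
    | some (Sum.inr j) => some (Sum.inl (j + i))
    | none => none

/-- The generators `X_{p,1}, …, X_{p,p}, W_{p,1}, …, W_{p,p}`. -/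
def gens (p : ℕ) : Set (FullTransf (Points p)) :=
  Set.range (genX p) ∪ Set.range (genW p)

/-- The semigroup `S_p = ⟨X_{p,1}, …, X_{p,p}, W_{p,1}, …, W_{p,p}⟩`. -/
def semigroupSp (p : ℕ) : Subsemigroup (FullTransf (Points p)) :=
  Subsemigroup.closure (gens p)

/-- A transformation of `Option Y` is a partial bijection of `Y` if it fixes `θ = none` and is
injective on the points that it does not map to `θ`. -/
def IsPartialBijection {Y : Type u} (f : FullTransf (Option Y)) : Prop :=
  f.unop none = none ∧ ∀ a b : Option Y, f.unop a ≠ none → f.unop a = f.unop b → a = b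

instance finite_fullTransf (X : Type u) [Finite X] : Finite (FullTransf X) :=
  haveI : Finite (Function.End X) := inferInstanceAs (Finite (X → X))
  Finite.of_injective (fun f => f.unop) MulOpposite.unop_injective

/-! ### The sequence `λ` under homomorphisms, and the closure properties of `SMN` -/

/-! `λ` commutes with homomorphisms and, once constant in `i`, stays constant. Closure under
subsemigroups and images is then immediate, and a finite product needs only the maximum of the
bounds of its factors.

For the rank, `S_p` lies outside `SMN` although its subsemigroups with fewer than `2p` generators
lie inside. A pseudoidentity in `n` variables only sees `n`-generated subsemigroups, so with `p > n`
no basis in at most `n` variables exists; a finite basis has bounded arity.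

The core is `exists_eq_genW_of_not_collapsed`. Elements of `S_p` are either some `W_κ` or of rank at
most one, and all products have rank at most one. If `λ` does not collapse, each `λ_{1,k}` is a
single arrow `a_k → b_k`, later `λ` shift the end points cyclically, and `z (n + 1)` must send `b_k`
to `a_{k+n+1}`. This forces every such `z` to be some `W_κ` and makes the indices of the `b_k` an
arithmetic progression modulo `p` with nonzero difference. As `p` is prime, all residues occur: the
subsemigroup contains every `W_κ` and moves every `α_c` to a point other than `θ`. The first
requires `p` generators, the second `p` further ones. -/

theorem List.map_intersperse {α β : Type*} (f : α → β) (a : α) (l : List α) :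
    (l.intersperse a).map f = (l.map f).intersperse (f a) := by
  induction l with
  | nil => rfl
  | cons b l ih =>
    cases l with
    | nil => rfl
    | cons c l => simpa using ih

theorem map_strongLambda {M N : Type*} [Monoid M] [Monoid N] (f : M →* N) {t : ℕ}
    (x : Fin t → M) (z : ℕ → M) (n : ℕ) (i : Fin t) :
    f (strongLambda x z n i) = strongLambda (fun k => f (x k)) (fun k => f (z k)) n i := by
  induction n generalizing i with
  | zero => rfl
  | succ n ih =>
    simp only [strongLambda, map_list_prod, List.map_intersperse, List.map_rotate, List.map_ofFn]
    congr 4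
    funext j
    exact ih j

theorem strongLambda_succ_of_forall_eq {M : Type*} [Monoid M] {t : ℕ} {x : Fin t → M}
    {z : ℕ → M} {n : ℕ} (h : ∀ i j, strongLambda x z n i = strongLambda x z n j) (i j : Fin t) :
    strongLambda x z (n + 1) i = strongLambda x z (n + 1) j := by
  have hl : List.ofFn (strongLambda x z n) = List.replicate t (strongLambda x z n i) := by
    rw [← List.ofFn_const]
    congr 1
    funext k
    exact h k i
  simp only [strongLambda, hl, List.rotate_replicate]

theorem strongLambda_eq_of_le {M : Type*} [Monoid M] {t : ℕ} {x : Fin t → M}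
    {z : ℕ → M} {n m : ℕ} (hnm : n ≤ m)
    (h : ∀ i j, strongLambda x z n i = strongLambda x z n j) :
    ∀ i j, strongLambda x z m i = strongLambda x z m j := by
  induction m, hnm using Nat.le_induction with
  | base => exact h
  | succ m _ ih => exact strongLambda_succ_of_forall_eq ih

theorem IsStronglyMalcevNilpotent.of_injective {S T : Type*} [Semigroup S] [Semigroup T]
    (f : T →ₙ* S) (hf : Function.Injective f) (h : IsStronglyMalcevNilpotent S) :
    IsStronglyMalcevNilpotent T := by
  obtain ⟨n, hn, h⟩ := h
  refine ⟨n, hn, fun t x z i j => ?_⟩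
  have hinj : Function.Injective (WithOne.mapMulHom f) := by
    intro a b hab
    induction a with
    | one =>
      induction b with
      | one => rfl
      | coe b => simp at hab
    | coe a =>
      induction b with
      | one => simp at hab
      | coe b => simpa [hf.eq_iff] using hab
  apply hinj
  rw [map_strongLambda, map_strongLambda]
  simpa using h t (fun k => f (x k)) (fun k => WithOne.mapMulHom f (z k)) i j

theorem IsStronglyMalcevNilpotent.of_surjective {S T : Type*} [Semigroup S] [Semigroup T]
    (f : S →ₙ* T) (hf : Function.Surjective f) (h : IsStronglyMalcevNilpotent S) :
    IsStronglyMalcevNilpotent T := by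
  obtain ⟨n, hn, h⟩ := h
  refine ⟨n, hn, fun t x z i j => ?_⟩
  have hsurj : Function.Surjective (WithOne.mapMulHom f) := by
    intro a
    induction a with
    | one => exact ⟨1, map_one _⟩
    | coe a =>
      obtain ⟨b, rfl⟩ := hf a
      exact ⟨b, by simp⟩
  choose x' hx' using fun k => hf (x k)
  choose z' hz' using fun k => hsurj (z k)
  have := congrArg (WithOne.mapMulHom f) (h t x' z' i j)
  rw [map_strongLambda, map_strongLambda] at this
  simpa [hx', hz'] using this

theorem IsStronglyMalcevNilpotent.pi {ι : Type*} [Finite ι] {S : ι → Type*}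
    [∀ i, Semigroup (S i)] (h : ∀ i, IsStronglyMalcevNilpotent (S i)) :
    IsStronglyMalcevNilpotent (∀ i, S i) := by
  cases nonempty_fintype ι
  choose n hn h using h
  -- The `+ 1` keeps the bound positive for an empty family, whose supremum is `0`.
  refine ⟨Finset.univ.sup n + 1, Nat.succ_pos _, fun t x z i j => ?_⟩
  rcases isEmpty_or_nonempty ι with hι | hι
  · refine strongLambda_eq_of_le (n := 0) (Nat.zero_le _) (fun a b => ?_) i j
    simp only [strongLambda]
    rw [Subsingleton.elim (x a) (x b)]
  · have hinj : ∀ a b : WithOne (∀ i, S i),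
        (∀ k, WithOne.mapMulHom (Pi.evalMulHom S k) a = WithOne.mapMulHom (Pi.evalMulHom S k) b) →
          a = b := by
      intro a b hab
      induction a with
      | one =>
        induction b with
        | one => rfl
        | coe b => simpa using hab hι.some
      | coe a =>
        induction b with
        | one => simpa using hab hι.some
        | coe b =>
          congr 1
          funext k
          simpa using hab k
    apply hinj
    intro k
    rw [map_strongLambda, map_strongLambda]
    refine strongLambda_eq_of_le (n := n k)
      ((Finset.le_sup (Finset.mem_univ k)).trans (Nat.le_succ _)) ?_ i j
    simpa using h k t (fun l => x l k) (fun l => WithOne.mapMulHom (Pi.evalMulHom S k) (z l))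

theorem isPseudovariety_SMN : IsPseudovariety SMN where
  subsemigroup _ _ _ T h := h.of_injective (MulMemClass.subtype T) Subtype.val_injective
  image _ _ _ _ _ _ f hf h := h.of_surjective f hf
  prod _ _ _ _ _ h := IsStronglyMalcevNilpotent.pi h

/-! ### Pseudoidentities and subsemigroups -/

theorem evalProfinite_eq_lift {A : Type*} {S : Type} [Semigroup S] [Finite S] {φ : A → S}
    {π : freeProfiniteSemigroup A} {w : FreeSemigroup A}
    (h : π.1 (evalCon φ) = (w : (evalCon φ).1.Quotient)) :
    evalProfinite φ π = FreeSemigroup.lift φ w := by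
  unfold evalProfinite
  rw [h]
  rfl

/-- The kernel of `φ̂` is contained in that of its composite with `f`, so one word representing `π`
modulo the first also represents it modulo the second. -/
theorem map_evalProfinite {A : Type*} {S T : Type} [Semigroup S] [Finite S] [Semigroup T]
    [Finite T] (f : S →ₙ* T) (φ : A → S) (π : freeProfiniteSemigroup A) :
    f (evalProfinite φ π) = evalProfinite (fun a => f (φ a)) π := by
  have hcomp : ∀ w, FreeSemigroup.lift (fun a => f (φ a)) w = f (FreeSemigroup.lift φ w) := by
    intro w
    exact DFunLike.congr_fun
      (FreeSemigroup.hom_ext (f := FreeSemigroup.lift fun a => f (φ a))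
        (g := f.comp (FreeSemigroup.lift φ)) (by funext a; simp)) w
  obtain ⟨w, hw⟩ := Quotient.exists_rep (π.1 (evalCon φ))
  have hw' : π.1 (evalCon φ) = (w : (evalCon φ).1.Quotient) := hw.symm
  have hle : (evalCon φ).1 ≤ (evalCon fun a => f (φ a)).1 := by
    intro u v huv
    have huv' : FreeSemigroup.lift φ u = FreeSemigroup.lift φ v := huv
    change FreeSemigroup.lift (fun a => f (φ a)) u = FreeSemigroup.lift (fun a => f (φ a)) v
    rw [hcomp, hcomp, huv']
  rw [evalProfinite_eq_lift hw', evalProfinite_eq_lift (π.2 _ _ hle w hw'), hcomp]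

/-- If every subsemigroup of `S` with at most `n` generators lies in `V`, then `S` satisfies the
pseudoidentities of `V` in at most `n` variables. -/
theorem satisfiesPseudoidentity_of_forall_closure {V : FiniteSemigroupClass}
    {E : Set Pseudoidentity} (hE : IsPseudoidentityBasis E V) {S : Type} [Semigroup S] [Finite S]
    [Nonempty S] {n : ℕ} (hS : ∀ x : Fin n → S, V (Subsemigroup.closure (Set.range x)))
    {e : Pseudoidentity} (he : e ∈ E) (hn : e.arity ≤ n) : SatisfiesPseudoidentity S e := by
  intro φ
  -- Unused generator slots are padded with an arbitrary element, so that exactly `n` generators are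
  -- listed.
  let x : Fin n → S := fun k => if h : (k : ℕ) < e.arity then φ ⟨k, h⟩ else Classical.arbitrary S
  let ψ : Fin e.arity → Subsemigroup.closure (Set.range x) := fun k =>
    ⟨φ k, Subsemigroup.subset_closure ⟨Fin.castLE hn k, by simp [x]⟩⟩
  have h := congrArg (MulMemClass.subtype (Subsemigroup.closure (Set.range x)))
    ((hE _).1 (hS x) e he ψ)
  rw [map_evalProfinite, map_evalProfinite] at h
  exact h

/-! ### `λ` as a periodic sequence -/

section Sequence

variable {M : Type*} [Monoid M]

/-- The product `f k * z * f (k + 1) * z * ⋯ * z * f (k + m)`. -/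
def chainProd (f : ℕ → M) (z : M) : ℕ → ℕ → M
  | 0, k => f k
  | m + 1, k => f k * z * chainProd f z m (k + 1)

/-- The sequence `λ` with the second index read modulo `m + 1`. -/
def seqLambda (m : ℕ) (x : ℕ → M) (z : ℕ → M) : ℕ → ℕ → M
  | 0, k => x k
  | n + 1, k => chainProd (seqLambda m x z n) (z n) m k

theorem prod_intersperse_ofFn (f : ℕ → M) (z : M) (m k : ℕ) :
    ((List.ofFn fun j : Fin (m + 1) => f (k + j)).intersperse z).prod = chainProd f z m k := by
  induction m generalizing k with
  | zero => simp [chainProd]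
  | succ m ih =>
    rw [chainProd, ← ih (k + 1), List.ofFn_succ, List.ofFn_succ, List.ofFn_succ]
    simp [mul_assoc, add_comm, add_left_comm]

theorem chainProd_periodic {f : ℕ → M} {T : ℕ} (hf : ∀ k, f (k + T) = f k) (z : M) (m k : ℕ) :
    chainProd f z m (k + T) = chainProd f z m k := by
  induction m generalizing k with
  | zero => exact hf k
  | succ m ih =>
    rw [chainProd, chainProd, hf, show k + T + 1 = k + 1 + T by ring, ih]

theorem seqLambda_periodic {m : ℕ} {x : ℕ → M} (hx : ∀ k, x (k + (m + 1)) = x k) (z : ℕ → M)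
    (n k : ℕ) : seqLambda m x z n (k + (m + 1)) = seqLambda m x z n k := by
  induction n generalizing k with
  | zero => exact hx k
  | succ n ih => exact chainProd_periodic ih _ _ _

/-- Rotating the list amounts to shifting the index of a periodic sequence, which allows index
arithmetic in `ℕ`. -/
theorem strongLambda_eq_seqLambda {m : ℕ} (x : Fin (m + 1) → M) (z : ℕ → M) (n : ℕ)
    (i : Fin (m + 1)) :
    strongLambda x z n i = seqLambda m (fun k => x (Fin.ofNat (m + 1) k)) z n i := by
  induction n generalizing i with
  | zero => simp [strongLambda, seqLambda]
  | succ n ih =>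
    have hper : ∀ k, seqLambda m (fun k => x (Fin.ofNat (m + 1) k)) z n (k % (m + 1)) =
        seqLambda m (fun k => x (Fin.ofNat (m + 1) k)) z n k := by
      intro k
      have h : Function.Periodic (seqLambda m (fun k => x (Fin.ofNat (m + 1) k)) z n) (m + 1) :=
        seqLambda_periodic (fun k => by congr 1; ext; simp) z n
      exact h.map_mod_nat k
    rw [strongLambda, seqLambda, ← prod_intersperse_ofFn]
    congr 2
    apply List.ext_getElem
    · simp
    · intro j h₁ h₂
      rw [List.getElem_rotate, List.getElem_ofFn, List.getElem_ofFn, ih]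
      simp only [List.length_ofFn, hper, add_comm]

end Sequence

section Sequence

variable {M : Type*} [Monoid M]

theorem chainProd_eq_of_forall_eq {f : ℕ → M} (hf : ∀ k l, f k = f l) (z : M) (m k l : ℕ) :
    chainProd f z m k = chainProd f z m l := by
  induction m generalizing k l with
  | zero => exact hf k l
  | succ m ih => rw [chainProd, chainProd, hf k l, ih (k + 1) (l + 1)]

theorem seqLambda_eq_of_le {m : ℕ} {x : ℕ → M} {z : ℕ → M} {n n' : ℕ} (hn : n ≤ n')
    (h : ∀ k l, seqLambda m x z n k = seqLambda m x z n l) :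
    ∀ k l, seqLambda m x z n' k = seqLambda m x z n' l := by
  induction n', hn using Nat.le_induction with
  | base => exact h
  | succ n' _ ih => exact chainProd_eq_of_forall_eq ih _ _

theorem chainProd_mem {T : Subsemigroup M} {f : ℕ → M} (hf : ∀ k, f k ∈ T) {z : M}
    (hz : z = 1 ∨ z ∈ T) (m k : ℕ) : chainProd f z m k ∈ T := by
  induction m generalizing k with
  | zero => exact hf k
  | succ m ih =>
    refine T.mul_mem ?_ (ih _)
    rcases hz with rfl | hz
    · simpa using hf k
    · exact T.mul_mem (hf k) hz

theorem seqLambda_mem {T : Subsemigroup M} {x : ℕ → M} (hx : ∀ k, x k ∈ T) {z : ℕ → M}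
    (hz : ∀ n, z n = 1 ∨ z n ∈ T) (m n k : ℕ) : seqLambda m x z n k ∈ T := by
  induction n generalizing k with
  | zero => exact hx k
  | succ n ih => exact chainProd_mem ih (hz n) m k

end Sequence

/-! ### Partial bijections of rank at most one -/

section Transformations

variable {Y : Type*}

theorem unop_mul_apply (f g : FullTransf (Option Y)) (a : Option Y) :
    (f * g).unop a = g.unop (f.unop a) := rfl

/-- `f` fixes `θ` and maps at most one point to a point other than `θ`. -/
def HasRankLeOne (f : FullTransf (Option Y)) : Prop :=
  f.unop none = none ∧ ∀ a b : Option Y, f.unop a ≠ none → f.unop b ≠ none → a = b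

/-- The constant transformation with value `θ`. -/
def zeroTransf (Y : Type*) : FullTransf (Option Y) := MulOpposite.op fun _ => none

theorem HasRankLeOne.isPartialBijection {f : FullTransf (Option Y)} (hf : HasRankLeOne f) :
    IsPartialBijection f :=
  ⟨hf.1, fun a b ha hab => hf.2 a b ha (hab ▸ ha)⟩

theorem HasRankLeOne.mul_right {f g : FullTransf (Option Y)} (hf : HasRankLeOne f)
    (hg : g.unop none = none) : HasRankLeOne (f * g) := by
  refine ⟨by rw [unop_mul_apply, hf.1, hg], fun a b ha hb => ?_⟩
  rw [unop_mul_apply] at ha hb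
  exact hf.2 a b (fun h => ha (by rw [h, hg])) (fun h => hb (by rw [h, hg]))

theorem HasRankLeOne.mul_left {f g : FullTransf (Option Y)} (hf : HasRankLeOne f)
    (hg : IsPartialBijection g) : HasRankLeOne (g * f) := by
  refine ⟨by rw [unop_mul_apply, hg.1, hf.1], fun a b ha hb => ?_⟩
  rw [unop_mul_apply] at ha hb
  exact hg.2 a b (fun h => ha (by rw [h, hf.1])) (hf.2 _ _ ha hb)

theorem HasRankLeOne.ext {f g : FullTransf (Option Y)} (hf : HasRankLeOne f)
    (hg : HasRankLeOne g) {a b : Option Y} (hb : b ≠ none) (hfa : f.unop a = b)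
    (hga : g.unop a = b) : f = g := by
  apply MulOpposite.unop_injective
  funext y
  by_cases hy : y = a
  · rw [hy, hfa, hga]
  · have h₁ : f.unop y = none := by
      by_contra h
      exact hy (hf.2 y a h (hfa ▸ hb))
    have h₂ : g.unop y = none := by
      by_contra h
      exact hy (hg.2 y a h (hga ▸ hb))
    rw [h₁, h₂]

theorem exists_apply_eq_some {f : FullTransf (Option Y)} (hf : f.unop none = none)
    (h : f ≠ zeroTransf Y) : ∃ a b, f.unop (some a) = some b := by
  by_contra! hcon
  apply h
  apply MulOpposite.unop_injective
  funext y
  cases y with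
  | none => exact hf
  | some a =>
    change f.unop (some a) = none
    rw [Option.eq_none_iff_forall_ne_some]
    exact hcon a

theorem chainProd_apply_none {f : ℕ → FullTransf (Option Y)} (hf : ∀ k, (f k).unop none = none)
    {z : FullTransf (Option Y)} (hz : z.unop none = none) (m k : ℕ) :
    (chainProd f z m k).unop none = none := by
  induction m generalizing k with
  | zero => exact hf k
  | succ m ih => rw [chainProd, unop_mul_apply, unop_mul_apply, hf, hz, ih]

theorem chainProd_apply {f : ℕ → FullTransf (Option Y)} {z : FullTransf (Option Y)}
    {a b : ℕ → Y} (hf : ∀ k, (f k).unop (some (a k)) = some (b k))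
    (hz : ∀ k, z.unop (some (b k)) = some (a (k + 1))) (m k : ℕ) :
    (chainProd f z m k).unop (some (a k)) = some (b (k + m)) := by
  induction m generalizing k with
  | zero => exact hf k
  | succ m ih =>
    rw [chainProd, unop_mul_apply, unop_mul_apply, hf, hz, ih, add_assoc, add_comm 1]

theorem ne_zeroTransf_of_chainProd {f : ℕ → FullTransf (Option Y)}
    (hf : ∀ k, (f k).unop none = none) {z : FullTransf (Option Y)} (hz : z.unop none = none)
    {m k : ℕ} (h : chainProd f z m k ≠ zeroTransf Y) {i : ℕ} (hi : i ≤ m) :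
    f (k + i) ≠ zeroTransf Y := by
  induction m generalizing k i with
  | zero =>
    obtain rfl : i = 0 := by omega
    exact h
  | succ m ih =>
    intro hfi
    apply h
    apply MulOpposite.unop_injective
    funext y
    change (chainProd f z (m + 1) k).unop y = none
    rw [chainProd, unop_mul_apply, unop_mul_apply]
    cases i with
    | zero =>
      rw [add_zero] at hfi
      have : (f k).unop y = none := by rw [hfi]; rfl
      rw [this, hz, chainProd_apply_none hf hz]
    | succ i =>
      have : chainProd f z m (k + 1) = zeroTransf Y := by
        by_contra hne
        exact ih hne (i := i) (by omega) (by rw [← hfi]; congr 1; omega)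
      rw [this]
      rfl

/-- A point surviving the product must start at `a k`, the only point that `f k` does not kill.
After `z` it must sit at `a (k + 1)`, the only point surviving the next factor; the length `m + 1`
guarantees that this factor exists. -/
theorem apply_eq_some_of_chainProd {f : ℕ → FullTransf (Option Y)}
    (hf : ∀ k, HasRankLeOne (f k)) {z : FullTransf (Option Y)} (hz : z.unop none = none)
    {a b : ℕ → Y} (hab : ∀ k, (f k).unop (some (a k)) = some (b k)) {m k : ℕ}
    (h : chainProd f z (m + 1) k ≠ zeroTransf Y) :
    z.unop (some (b k)) = some (a (k + 1)) := by
  have hnone : ∀ m k, (chainProd f z m k).unop none = none :=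
    chainProd_apply_none (fun k => (hf k).1) hz
  obtain ⟨c, d, hcd⟩ := exists_apply_eq_some (hnone _ _) h
  rw [chainProd, unop_mul_apply, unop_mul_apply] at hcd
  have hc : some c = some (a k) := by
    refine (hf k).2 _ _ (fun h' => ?_) (by rw [hab]; simp)
    rw [h', hz, hnone] at hcd
    simp at hcd
  rw [hc, hab] at hcd
  refine (hf (k + 1)).2 _ _ (fun h' => ?_) (by rw [hab]; simp)
  cases m with
  | zero =>
    rw [chainProd, h'] at hcd
    simp at hcd
  | succ m =>
    rw [chainProd, unop_mul_apply, unop_mul_apply, h', hz, hnone] at hcd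
    simp at hcd

end Transformations

/-! ### The elements of `S_p` -/

section Generators

variable {p : ℕ}

theorem genX_apply_none (i : ZMod p) : (genX p i).unop none = none := rfl

theorem genX_apply_inl (i j : ZMod p) :
    (genX p i).unop (some (Sum.inl j)) = if j = i then some (Sum.inr i) else none := rfl

theorem genX_apply_inr (i j : ZMod p) : (genX p i).unop (some (Sum.inr j)) = none := rfl

theorem genX_apply_self (i : ZMod p) :
    (genX p i).unop (some (Sum.inl i)) = some (Sum.inr i) := by
  rw [genX_apply_inl, if_pos rfl]

theorem genW_apply_none (i : ZMod p) : (genW p i).unop none = none := rfl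

theorem genW_apply_inl (i j : ZMod p) : (genW p i).unop (some (Sum.inl j)) = none := rfl

theorem genW_apply_inr (i j : ZMod p) :
    (genW p i).unop (some (Sum.inr j)) = some (Sum.inl (j + i)) := rfl

theorem hasRankLeOne_genX (i : ZMod p) : HasRankLeOne (genX p i) := by
  refine ⟨rfl, ?_⟩
  rintro (_ | a | a) (_ | b | b) <;>
    simp only [genX_apply_none, genX_apply_inl, genX_apply_inr] <;> grind

theorem isPartialBijection_genW (i : ZMod p) : IsPartialBijection (genW p i) := by
  refine ⟨rfl, ?_⟩
  rintro (_ | a | a) (_ | b | b) <;>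
    simp [genW_apply_none, genW_apply_inl, genW_apply_inr]

theorem genW_eq_of_apply {i : ZMod p} {c : Points p} {y : ZMod p ⊕ ZMod p}
    (h : (genW p i).unop c = some y) : ∃ β, c = some (Sum.inr β) ∧ y = Sum.inl (β + i) := by
  rcases c with _ | α | β
  · simp [genW_apply_none] at h
  · simp [genW_apply_inl] at h
  · exact ⟨β, rfl, by simpa [genW_apply_inr] using h.symm⟩

theorem genW_mul_genW_hasRankLeOne (i j : ZMod p) : HasRankLeOne (genW p i * genW p j) := by
  refine ⟨rfl, ?_⟩
  rintro (_ | a | a) b h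
  all_goals exact absurd rfl h

theorem genX_injective : Function.Injective (genX p) := by
  intro i j h
  have h' := congrArg (fun f => f.unop (some (Sum.inl i))) h
  simp only [genX_apply_self] at h'
  by_contra hij
  simp [genX_apply_inl, hij] at h'

theorem genW_injective : Function.Injective (genW p) := by
  intro i j h
  have h' := congrArg (fun f => f.unop (some (Sum.inr 0))) h
  simpa [genW_apply_inr] using h'

theorem genX_ne_genW (i j : ZMod p) : genX p i ≠ genW p j := by
  intro h
  have h' := congrArg (fun f => f.unop (some (Sum.inl i))) h
  simp [genX_apply_self, genW_apply_inl] at h'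

theorem isPartialBijection_of_mem_gens {f : FullTransf (Points p)} (hf : f ∈ gens p) :
    IsPartialBijection f := by
  rcases hf with ⟨i, rfl⟩ | ⟨i, rfl⟩
  · exact (hasRankLeOne_genX i).isPartialBijection
  · exact isPartialBijection_genW i

theorem ncard_gens [NeZero p] : (gens p).ncard = 2 * p := by
  rw [gens, Set.ncard_union_eq]
  · rw [← Set.image_univ, ← Set.image_univ, Set.ncard_image_of_injective _ genX_injective,
      Set.ncard_image_of_injective _ genW_injective, Set.ncard_univ, Nat.card_zmod, two_mul]
  · rw [Set.disjoint_left]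
    rintro _ ⟨i, rfl⟩ ⟨j, h⟩
    exact genX_ne_genW i j h.symm

theorem not_hasRankLeOne_genW (hp : 1 < p) (i : ZMod p) : ¬ HasRankLeOne (genW p i) := by
  intro h
  have : Fact (1 < p) := ⟨hp⟩
  simpa using h.2 (some (Sum.inr 0)) (some (Sum.inr 1)) (by simp [genW_apply_inr]) (by simp [genW_apply_inr])

/-- The product of two `W`s is zero, since `W` maps into `A_p ∪ {θ}` and kills `A_p`. Otherwise a
factor of rank at most one bounds the rank. -/
theorem hasRankLeOne_mul_of {f g : FullTransf (Points p)}
    (hf : (∃ i, f = genW p i) ∨ HasRankLeOne f) (hg : (∃ i, g = genW p i) ∨ HasRankLeOne g) :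
    HasRankLeOne (f * g) := by
  rcases hf with ⟨i, rfl⟩ | hf
  · rcases hg with ⟨j, rfl⟩ | hg
    · exact genW_mul_genW_hasRankLeOne i j
    · exact hg.mul_left (isPartialBijection_genW i)
  · rcases hg with ⟨j, rfl⟩ | hg
    · exact hf.mul_right rfl
    · exact hf.mul_right hg.1

theorem mem_semigroupSp {f : FullTransf (Points p)} (hf : f ∈ semigroupSp p) :
    (∃ i, f = genW p i) ∨ HasRankLeOne f := by
  induction hf using Subsemigroup.closure_induction with
  | mem f hf =>
    rcases hf with ⟨i, rfl⟩ | ⟨i, rfl⟩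
    · exact .inr (hasRankLeOne_genX i)
    · exact .inl ⟨i, rfl⟩
  | mul f g _ _ hf hg => exact .inr (hasRankLeOne_mul_of hf hg)

theorem isPartialBijection_of_mem_semigroupSp {f : FullTransf (Points p)}
    (hf : f ∈ semigroupSp p) : IsPartialBijection f := by
  rcases mem_semigroupSp hf with ⟨i, rfl⟩ | h
  · exact isPartialBijection_genW i
  · exact h.isPartialBijection

theorem unop_one_apply (a : Points p) : (1 : FullTransf (Points p)).unop a = a := rfl

/-- This makes `T¹` embed in the transformation monoid for `T ≤ S_p`, so that `λ` can be computed
with transformations. -/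
theorem one_notMem_semigroupSp : (1 : FullTransf (Points p)) ∉ semigroupSp p := by
  intro h
  rcases mem_semigroupSp h with ⟨i, hi⟩ | h
  · have h' := congrArg (fun f => f.unop (some (Sum.inl 0))) hi
    simp [genW_apply_inl, unop_one_apply] at h'
  · simpa using h.2 (some (Sum.inl 0)) (some (Sum.inr 0)) (by simp [unop_one_apply])
      (by simp [unop_one_apply])

/-- The monoid homomorphism from `T¹` to the full transformation monoid. -/
def withOneHom (T : Subsemigroup (FullTransf (Points p))) : WithOne T →* FullTransf (Points p) :=
  WithOne.lift (MulMemClass.subtype T)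

theorem withOneHom_coe {T : Subsemigroup (FullTransf (Points p))} (t : T) :
    withOneHom T t = t.1 := rfl

theorem withOneHom_eq_one_or_mem {T : Subsemigroup (FullTransf (Points p))} (a : WithOne T) :
    withOneHom T a = 1 ∨ withOneHom T a ∈ T := by
  cases a with
  | one => exact .inl (map_one _)
  | coe t => exact .inr t.2

theorem withOneHom_injective {T : Subsemigroup (FullTransf (Points p))} (hT : T ≤ semigroupSp p) :
    Function.Injective (withOneHom T) := by
  have hne : ∀ t : T, withOneHom T t ≠ 1 := fun t h =>
    one_notMem_semigroupSp (h ▸ hT t.2 : (1 : FullTransf (Points p)) ∈ semigroupSp p)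
  intro a b h
  cases a with
  | one =>
    cases b with
    | one => rfl
    | coe b => exact absurd (h.symm.trans (map_one _)) (hne b)
  | coe a =>
    cases b with
    | one => exact absurd (h.trans (map_one _)) (hne a)
    | coe b => exact congrArg _ (Subtype.ext h)

end Generators

/-! ### Subsemigroups of `S_p` that are not strongly Mal'cev nilpotent -/

section Core

variable {p : ℕ}

/-- If `λ` has not collapsed after `N + 3` steps, then from the first step on it consists of
nonzero transformations of rank one, and `z` shifts their end points to their starting points. -/
theorem exists_points_of_not_collapsed {m : ℕ} {x z : ℕ → FullTransf (Points p)} (N : ℕ)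
    (hper : ∀ k, x (k + (m + 1)) = x k) (hx : ∀ k, x k ∈ semigroupSp p)
    (hz : ∀ n, z n = 1 ∨ z n ∈ semigroupSp p)
    (hne : ¬ ∀ k l, seqLambda m x z (N + 3) k = seqLambda m x z (N + 3) l) :
    ∃ a b : ℕ → ZMod p ⊕ ZMod p,
      (∀ k, a (k + (m + 1)) = a k) ∧
      (¬ ∀ k l, a k = a l ∧ b k = b l) ∧
      (∀ k, (seqLambda m x z 1 k).unop (some (a k)) = some (b k)) ∧
      ∀ n ≤ N, ∀ k, (z (n + 1)).unop (some (b k)) = some (a (k + n + 1)) := by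
  have hL := seqLambda_periodic hper z
  have hnc : ∀ n ≤ N + 3, ¬ ∀ k l, seqLambda m x z n k = seqLambda m x z n l :=
    fun n hn h => hne (seqLambda_eq_of_le hn h)
  have hz0 : ∀ n, (z n).unop none = none := by
    intro n
    rcases hz n with h | h
    · rw [h]; rfl
    · exact (isPartialBijection_of_mem_semigroupSp h).1
  have hmem := seqLambda_mem hx hz m
  -- For `t = 1` there is nothing to distinguish. For `t ≥ 2` every later `λ` is a genuine product,
  -- hence of rank at most one.
  obtain _ | m := m
  · refine absurd (fun k l => ?_) (hnc 0 (Nat.zero_le _))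
    have h : Function.Periodic x 1 := hper
    have h' : ∀ k, x k = x 0 := fun k => by simpa using h.nat_mul k 0
    exact (h' k).trans (h' l).symm
  have hR : ∀ n k, HasRankLeOne (seqLambda (m + 1) x z (n + 1) k) := by
    intro n k
    rw [seqLambda, chainProd]
    refine hasRankLeOne_mul_of ?_ (mem_semigroupSp (chainProd_mem (hmem n) (hz n) m _))
    rcases hz n with h | h
    · rw [h, mul_one]
      exact mem_semigroupSp (hmem n k)
    · exact .inr (hasRankLeOne_mul_of (mem_semigroupSp (hmem n k)) (mem_semigroupSp h))
  -- Each `λ` at level `n + 1` contains every `λ` of level `n` as a factor, so a single zero would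
  -- collapse the next level.
  have hnz : ∀ n ≤ N + 2, ∀ j, seqLambda (m + 1) x z n j ≠ zeroTransf _ := by
    intro n hn j hj
    apply hnc (n + 1) (by omega)
    suffices h : ∀ k, seqLambda (m + 1) x z (n + 1) k = zeroTransf _ from
      fun k l => (h k).trans (h l).symm
    intro k
    by_contra hk
    have hP : Function.Periodic (seqLambda (m + 1) x z n) (m + 1 + 1) := hL n
    have hlt : (j + (m + 1) * k) % (m + 2) < m + 2 := Nat.mod_lt _ (by omega)
    -- The factor with index `j` sits at position `j - k` modulo `m + 2`, and `m + 1` plays the role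
    -- of `-1`.
    refine ne_zeroTransf_of_chainProd
      (fun k => (isPartialBijection_of_mem_semigroupSp (hmem n k)).1) (hz0 n) hk
      (i := (j + (m + 1) * k) % (m + 2)) (by omega) ?_
    rw [← hP.map_mod_nat, Nat.add_mod_mod,
      show k + (j + (m + 1) * k) = j + (m + 1 + 1) * k by ring, Nat.add_mul_mod_self_left,
      hP.map_mod_nat, hj]
  have hab : ∀ k, ∃ a b, (seqLambda (m + 1) x z 1 k).unop (some a) = some b :=
    fun k => exists_apply_eq_some (hR 0 k).1 (hnz 1 (by omega) k)
  choose a b hab using hab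
  have hshift : ∀ n ≤ N, (∀ k, (seqLambda (m + 1) x z (n + 1) k).unop (some (a k)) =
      some (b (k + n * (m + 1)))) → ∀ k, (z (n + 1)).unop (some (b (k + n * (m + 1)))) =
        some (a (k + 1)) := by
    intro n hn h k
    exact apply_eq_some_of_chainProd (hR n) (hz0 _) h (hnz (n + 2) (by omega) k)
  have hall : ∀ n ≤ N, ∀ k, (seqLambda (m + 1) x z (n + 1) k).unop (some (a k)) =
      some (b (k + n * (m + 1))) := by
    intro n
    induction n with
    | zero => intro _ k; simpa using hab k
    | succ n ih =>
      intro hn k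
      have := chainProd_apply (ih (by omega)) (hshift n (by omega) (ih (by omega))) (m + 1) k
      rw [seqLambda, this]
      congr 2
      ring
  have hperab : ∀ k, a (k + (m + 2)) = a k ∧ b (k + (m + 2)) = b k := by
    intro k
    have h := hab (k + (m + 2))
    rw [hL 1 k] at h
    have h' := (hR 0 k).2 _ _ (by rw [h]; simp) (by rw [hab k]; simp)
    rw [h', hab k] at h
    exact ⟨Option.some_injective _ h', (Option.some_injective _ h).symm⟩
  have hPb : Function.Periodic b (m + 2) := fun k => (hperab k).2
  refine ⟨a, b, fun k => (hperab k).1, fun h => ?_, hab, fun n hn k => ?_⟩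
  · refine hnc 1 (by omega) fun k l => (hR 0 k).ext (hR 0 l) (by simp) (hab k) ?_
    rw [(h k l).1, (h k l).2]
    exact hab l
  -- Starting at `k + n` turns the shift `n * (m + 1)` into a multiple of the period.
  · have := hshift n hn (hall n hn) (k + n)
    rw [show k + n + n * (m + 1) = k + n * (m + 2) by ring] at this
    have hb : b (k + n * (m + 2)) = b k := by simpa using hPb.nat_mul n k
    rwa [hb] at this

variable [Fact p.Prime]

/-- If `λ` has not collapsed after `p + 3` steps, then all `W_{p,κ}` occur among the `z_n`, and
every point of `A_p` is the starting point of some `λ_{1,k}`. -/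
theorem exists_eq_genW_of_not_collapsed {m : ℕ} {x z : ℕ → FullTransf (Points p)}
    (hper : ∀ k, x (k + (m + 1)) = x k) (hx : ∀ k, x k ∈ semigroupSp p)
    (hz : ∀ n, z n = 1 ∨ z n ∈ semigroupSp p)
    (hne : ¬ ∀ k l, seqLambda m x z (p + 3) k = seqLambda m x z (p + 3) l) :
    (∀ κ, ∃ n, z n = genW p κ) ∧
      ∀ c, ∃ k, (seqLambda m x z 1 k).unop (some (Sum.inl c)) ≠ none := by
  obtain ⟨a, b, ha, hab, hL, hzab⟩ := exists_points_of_not_collapsed p hper hx hz hne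
  have hp : 1 < p := (Fact.out : p.Prime).one_lt
  -- By periodicity, constancy from `s` on is constancy everywhere. Then `z 1`, injective off `θ`,
  -- makes `b` constant too.
  have haconst : ∀ s, ¬ ∀ k, a (k + s) = a s := by
    intro s h
    have hP : Function.Periodic a (m + 1) := ha
    have ha' : ∀ k, a k = a s := by
      intro k
      rw [← hP.nat_mul s k, ← h (k + s * m)]
      congr 1
      push_cast
      ring
    refine hab fun k l => ⟨(ha' k).trans (ha' l).symm, ?_⟩
    have hb : ∀ k, (z 1).unop (some (b k)) = some (a s) := by
      intro k
      rw [hzab 0 (Nat.zero_le _) k, ha']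
    have hpb : IsPartialBijection (z 1) := by
      rcases hz 1 with h | h
      · rw [h]
        exact ⟨rfl, fun _ _ _ h => h⟩
      · exact isPartialBijection_of_mem_semigroupSp h
    exact Option.some_injective _
      (hpb.2 _ _ (by rw [hb]; simp) ((hb k).trans (hb l).symm))
  have hz' : ∀ n ≤ p, z (n + 1) = 1 ∨ ∃ κ, z (n + 1) = genW p κ := by
    intro n hn
    rcases hz (n + 1) with h | h
    · exact .inl h
    · rcases mem_semigroupSp h with h | h
      · exact .inr h
      · refine absurd (fun k => ?_) (haconst (n + 1))
        have hb := h.2 (some (b k)) (some (b 0)) (by rw [hzab n hn]; simp)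
          (by rw [hzab n hn]; simp)
        have h₁ := hzab n hn k
        rw [hb, hzab n hn 0, zero_add] at h₁
        exact (Option.some_injective _ h₁).symm
  -- If `z 1 = 1`, then `b k = a (k + 1)`. Now `z 2 = 1` makes `a` constant from `1` on, while `z 2
  -- = W_κ` would put `a 2 = b 1` in both `A_p` and `B_p`.
  obtain h1 | ⟨κ₀, hκ₀⟩ := hz' 0 (Nat.zero_le _)
  · have hb : ∀ k, b k = a (k + 1) := by
      intro k
      have := hzab 0 (Nat.zero_le _) k
      rw [h1] at this
      exact Option.some_injective _ this
    rcases hz' 1 hp.le with h2 | ⟨κ, hκ⟩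
    · refine absurd (fun k => ?_) (haconst 1)
      have hstep : ∀ k, a (k + 1) = a (k + 2) := by
        intro k
        have := hzab 1 hp.le k
        rw [h2, hb] at this
        exact Option.some_injective _ this
      induction k with
      | zero => rw [zero_add]
      | succ k ih => rw [← ih, hstep k]
    · have h₁ := hzab 1 hp.le 0
      have h₂ := hzab 1 hp.le 1
      rw [hκ] at h₁ h₂
      obtain ⟨β, -, hβ⟩ := genW_eq_of_apply h₁
      obtain ⟨β', hβ', -⟩ := genW_eq_of_apply h₂
      rw [hb] at hβ'
      simp only [zero_add] at hβ
      norm_num at hβ' hβ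
      rw [hβ] at hβ'
      simp at hβ'
  have hβ : ∀ k, ∃ β, b k = Sum.inr β ∧ a (k + 1) = Sum.inl (β + κ₀) := by
    intro k
    have := hzab 0 (Nat.zero_le _) k
    rw [hκ₀] at this
    obtain ⟨β, h₁, h₂⟩ := genW_eq_of_apply this
    exact ⟨β, Option.some_injective _ h₁, h₂⟩
  choose β hbβ haβ using hβ
  -- The identity is now excluded, because `z (n + 1)` carries a point of `B_p` to a point of `A_p`.
  have hW : ∀ n ≤ p, ∃ κ, z (n + 1) = genW p κ ∧ ∀ k, β k + κ = β (k + n) + κ₀ := by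
    intro n hn
    rcases hz' n hn with h | ⟨κ, hκ⟩
    · have := hzab n hn 0
      rw [h, hbβ, zero_add, haβ] at this
      simp [unop_one_apply] at this
    · refine ⟨κ, hκ, fun k => ?_⟩
      have := hzab n hn k
      rw [hκ, hbβ, haβ, genW_apply_inr] at this
      simpa using this
  obtain ⟨κ₁, -, hκ₁⟩ := hW 1 hp.le
  have hβk : ∀ k : ℕ, β k = β 0 + k * (κ₁ - κ₀) := by
    intro k
    induction k with
    | zero => simp
    | succ k ih =>
      push_cast
      linear_combination ih - hκ₁ k
  have hd : κ₁ - κ₀ ≠ 0 := by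
    intro hd
    refine haconst 1 fun k => ?_
    rw [haβ, hβk k, hd, ← zero_add 1, haβ]
    simp
  -- Primality enters here: the nonzero difference is invertible modulo `p`.
  have hsurj : ∀ c, ∃ n < p, β n = c := by
    intro c
    refine ⟨((c - β 0) / (κ₁ - κ₀)).val, ZMod.val_lt _, ?_⟩
    rw [hβk, ZMod.natCast_zmod_val, div_mul_cancel₀ _ hd]
    ring
  constructor
  · intro κ
    obtain ⟨n, hn, hβn⟩ := hsurj (β 0 + κ - κ₀)
    obtain ⟨κ', hκ', h⟩ := hW n hn.le
    refine ⟨n + 1, hκ'.trans ?_⟩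
    congr 1
    have := h 0
    rw [zero_add, hβn] at this
    linear_combination this
  · intro c
    obtain ⟨n, -, hβn⟩ := hsurj (c - κ₀)
    refine ⟨n + 1, ?_⟩
    have := haβ n
    rw [hβn, sub_add_cancel] at this
    rw [← this, hL]
    simp

/-- The level `p + 3` serves uniformly for all `t`, `x` and `z`; failure at that level already
produces the second alternative. -/
theorem isStronglyMalcevNilpotent_or (T : Subsemigroup (FullTransf (Points p)))
    (hT : T ≤ semigroupSp p) :
    IsStronglyMalcevNilpotent T ∨ ((∀ κ, genW p κ ∈ T) ∧
      ∀ c : ZMod p, ∃ f ∈ T, f.unop (some (Sum.inl c)) ≠ none) := by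
  refine or_iff_not_imp_left.2 fun h => ?_
  have h' : ∃ (m : ℕ) (x : Fin (m + 1) → T) (z : ℕ → WithOne T) (i j : Fin (m + 1)),
      strongLambda (fun k => (x k : WithOne T)) z (p + 3) i ≠
        strongLambda (fun k => (x k : WithOne T)) z (p + 3) j := by
    by_contra! hcon
    refine h ⟨p + 3, by omega, fun t x z i j => ?_⟩
    cases t with
    | zero => exact i.elim0
    | succ m => exact hcon m x z i j
  obtain ⟨m, x, z, i, j, hij⟩ := h'
  have hxT : ∀ k, ((x (Fin.ofNat (m + 1) k) : T) : FullTransf (Points p)) ∈ T :=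
    fun k => (x _).2
  have hzT := fun n => withOneHom_eq_one_or_mem (z n)
  obtain ⟨hW, hX⟩ := exists_eq_genW_of_not_collapsed (m := m)
    (x := fun k => (x (Fin.ofNat (m + 1) k)).1) (z := fun n => withOneHom T (z n))
    (fun k => by congr 2; ext; simp) (fun k => hT (hxT k)) (fun n => (hzT n).imp_right fun h => hT h)
    (fun hall => hij (withOneHom_injective hT (by
      rw [map_strongLambda, map_strongLambda, strongLambda_eq_seqLambda,
        strongLambda_eq_seqLambda]
      exact hall _ _)))
  refine ⟨fun κ => ?_, fun c => ?_⟩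
  · obtain ⟨n, hn⟩ := hW κ
    rcases hzT n with h1 | h1
    · have h2 := congrArg (fun f => f.unop (some (Sum.inl 0))) (h1.symm.trans hn)
      simp [unop_one_apply, genW_apply_inl] at h2
    · exact hn ▸ h1
  · obtain ⟨k, hk⟩ := hX c
    exact ⟨_, seqLambda_mem hxT hzT m 1 k, hk⟩

/-- A subsemigroup of `S_p` with fewer than `2 * p` generators is strongly Mal'cev nilpotent. -/
theorem isStronglyMalcevNilpotent_closure {n : ℕ} (hn : n < 2 * p)
    (y : Fin n → FullTransf (Points p)) (hy : ∀ k, y k ∈ semigroupSp p) :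
    IsStronglyMalcevNilpotent (Subsemigroup.closure (Set.range y)) := by
  have hp : 1 < p := (Fact.out : p.Prime).one_lt
  have hle : Subsemigroup.closure (Set.range y) ≤ semigroupSp p :=
    Subsemigroup.closure_le.2 (by rintro _ ⟨k, rfl⟩; exact hy k)
  refine (isStronglyMalcevNilpotent_or _ hle).resolve_right ?_
  rintro ⟨hW, hX⟩
  have hW' : ∀ κ, ∃ k, y k = genW p κ := by
    -- Proper products have rank at most one and `W_κ` has rank `p > 1`, so each `W_κ` must itself
    -- be a generator.
    have key : ∀ f ∈ Subsemigroup.closure (Set.range y), f ∈ Set.range y ∨ HasRankLeOne f := by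
      intro f hf
      induction hf using Subsemigroup.closure_induction with
      | mem f hf => exact .inl hf
      | mul f g hf hg _ _ =>
        exact .inr (hasRankLeOne_mul_of (mem_semigroupSp (hle hf)) (mem_semigroupSp (hle hg)))
    exact fun κ => (key _ (hW κ)).resolve_right (not_hasRankLeOne_genW hp κ)
  have hX' : ∀ c : ZMod p, ∃ k, (y k).unop (some (Sum.inl c)) ≠ none := by
    intro c
    by_contra! hcon
    obtain ⟨f, hf, hfc⟩ := hX c
    apply hfc
    clear hfc
    induction hf using Subsemigroup.closure_induction with
    | mem f hf =>
      obtain ⟨k, rfl⟩ := hf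
      exact hcon k
    | mul f g hf hg ihf _ =>
      rw [unop_mul_apply, ihf]
      exact (isPartialBijection_of_mem_semigroupSp (hle hg)).1
  choose u hu using hW'
  choose v hv using hX'
  -- A generator not killing `α_c` is no `W`, hence has rank at most one and serves only one `c`.
  -- This yields `2p` distinct generators.
  have hinj : Function.Injective (Sum.elim u v) := by
    rintro (κ | c) (κ' | c') h
    · simp only [Sum.elim_inl] at h
      rw [genW_injective ((hu κ).symm.trans ((congrArg y h).trans (hu κ')))]
    · simp only [Sum.elim_inl, Sum.elim_inr] at h
      exact absurd (by rw [← h, hu, genW_apply_inl]) (hv c')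
    · simp only [Sum.elim_inl, Sum.elim_inr] at h
      exact absurd (by rw [h, hu, genW_apply_inl]) (hv c)
    · simp only [Sum.elim_inr] at h
      rcases mem_semigroupSp (hy (v c)) with ⟨i, hi⟩ | hR
      · exact absurd (by rw [hi, genW_apply_inl]) (hv c)
      · have hc := hR.2 _ _ (hv c) (by rw [h]; exact hv c')
        rw [Sum.inl_injective (Option.some_injective _ hc)]
  have := Fintype.card_le_of_injective _ hinj
  rw [Fintype.card_sum, ZMod.card, Fintype.card_fin] at this
  omega

theorem isStronglyMalcevNilpotent_closure_semigroupSp {n : ℕ} (hn : n < 2 * p)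
    (x : Fin n → semigroupSp p) :
    IsStronglyMalcevNilpotent (Subsemigroup.closure (Set.range x)) := by
  have hle : Subsemigroup.closure (Set.range x) ≤
      (Subsemigroup.closure (Set.range fun k => (x k).1)).comap
        (MulMemClass.subtype (semigroupSp p)) :=
    Subsemigroup.closure_le.2 (by
      rintro _ ⟨k, rfl⟩
      exact Subsemigroup.subset_closure ⟨k, rfl⟩)
  refine (isStronglyMalcevNilpotent_closure hn (fun k => (x k).1) fun k => (x k).2).of_injective
    ⟨fun t => ⟨t.1.1, hle t.2⟩, fun _ _ => rfl⟩ fun a b h => ?_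
  exact Subtype.ext (Subtype.ext (congrArg (fun s => s.1) h))

/-- With `x_k = X_k` and `z n = W_{n+1}`, indices from `0`, `λ_{n,k}` sends `α_k` to `β_{k-n}` for
every `n`, and `W_{n+1}` carries `β_{k-n}` to `α_{k+1}`, so the chain never breaks. -/
theorem not_isStronglyMalcevNilpotent_semigroupSp :
    ¬ IsStronglyMalcevNilpotent (semigroupSp p) := by
  rintro ⟨n, -, h⟩
  obtain ⟨m, rfl⟩ : ∃ m, p = m + 1 + 1 :=
    ⟨p - 2, by have := (Fact.out : p.Prime).two_le; omega⟩
  set p := m + 1 + 1 with hp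
  have hX : ∀ i, genX p i ∈ semigroupSp p :=
    fun i => Subsemigroup.subset_closure (.inl ⟨i, rfl⟩)
  have hW : ∀ i, genW p i ∈ semigroupSp p :=
    fun i => Subsemigroup.subset_closure (.inr ⟨i, rfl⟩)
  have hlam : ∀ n k : ℕ, (seqLambda (m + 1) (fun k : ℕ => genX p (k : ZMod p))
      (fun n => genW p ((n : ZMod p) + 1)) n k).unop (some (Sum.inl (k : ZMod p))) =
        some (Sum.inr ((k : ZMod p) - n)) := by
    intro n
    induction n with
    | zero => intro k; simpa [seqLambda] using genX_apply_self (p := p) k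
    | succ n ih =>
      intro k
      rw [seqLambda, chainProd_apply (a := fun k => Sum.inl (k : ZMod p))
        (b := fun k => Sum.inr ((k : ZMod p) - n)) ih]
      · have : ((m + 1 : ℕ) : ZMod p) = -1 := by
          have h0 : ((m + 1 + 1 : ℕ) : ZMod p) = 0 := ZMod.natCast_self p
          push_cast at h0 ⊢
          linear_combination h0
        rw [Nat.cast_add, this]
        congr 2
        push_cast
        ring
      · intro k
        rw [genW_apply_inr]
        congr 2
        push_cast
        ring
  have h01 := h p (fun k => ⟨genX p ((k : ℕ) : ZMod p), hX _⟩)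
    (fun n => ((⟨genW p ((n : ZMod p) + 1), hW _⟩ : semigroupSp p) : WithOne (semigroupSp p)))
    0 1
  have h01' := congrArg (withOneHom (semigroupSp p)) h01
  rw [map_strongLambda, map_strongLambda] at h01'
  simp only [withOneHom_coe] at h01'
  rw [strongLambda_eq_seqLambda, strongLambda_eq_seqLambda] at h01'
  have hcast : (fun k : ℕ => genX p (((Fin.ofNat (m + 1 + 1) k : Fin (m + 1 + 1)) : ℕ) : ZMod p)) =
      fun k : ℕ => genX p (k : ZMod p) := by
    funext k
    congr 1
    simp [Fin.ofNat]
  rw [hcast] at h01'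
  have e0 := hlam n 0
  have e1 := hlam n 1
  have hf0 : ((0 : Fin p) : ℕ) = 0 := rfl
  have hf1 : ((1 : Fin p) : ℕ) = 1 := by simp [hp]
  rw [hf0, hf1] at h01'
  have hmem := seqLambda_mem (T := semigroupSp p) (x := fun k : ℕ => genX p (k : ZMod p))
    (fun k => hX _) (z := fun n : ℕ => genW p ((n : ZMod p) + 1)) (fun n => .inr (hW _)) (m + 1) n 1
  rw [h01'] at e0
  -- If `λ_{n,0} = λ_{n,1}`, this map keeps both `α_0` and `α_1` off `θ`; it is no `W`, so its rank
  -- is at most one and the two points coincide.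
  have : (some (Sum.inl ((0 : ℕ) : ZMod p)) : Points p) = some (Sum.inl ((1 : ℕ) : ZMod p)) := by
    rcases mem_semigroupSp hmem with ⟨i, hi⟩ | hR
    · rw [hi, genW_apply_inl] at e0
      simp at e0
    · exact hR.2 _ _ (by rw [e0]; simp) (by rw [e1]; simp)
  simp at this

end Core

/-! ### The rank of `SMN` -/

theorem not_exists_basis_of_arity_le (n : ℕ) (E : Set Pseudoidentity)
    (hn : ∀ e ∈ E, e.arity ≤ n) : ¬ IsPseudoidentityBasis E SMN := by
  intro hE
  obtain ⟨p, hnp, hp⟩ := Nat.exists_infinite_primes (n + 1)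
  have : Fact p.Prime := ⟨hp⟩
  have : Nonempty (semigroupSp p) :=
    ⟨⟨genX p 0, Subsemigroup.subset_closure (.inl ⟨0, rfl⟩)⟩⟩
  refine not_isStronglyMalcevNilpotent_semigroupSp (p := p) ((hE (semigroupSp p)).2 fun e he => ?_)
  exact satisfiesPseudoidentity_of_forall_closure hE
    (fun x => isStronglyMalcevNilpotent_closure_semigroupSp (by omega) x) he (hn e he)

theorem pseudovarietyRank_SMN : pseudovarietyRank SMN = ⊤ := by
  rw [pseudovarietyRank, sInf_eq_top]
  rintro _ ⟨n, -, E, hn, hE⟩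
  exact absurd hE (not_exists_basis_of_arity_le n E hn)

theorem not_isFinitelyBased_SMN : ¬ IsFinitelyBased SMN := by
  rintro ⟨E, hfin, hE⟩
  obtain ⟨n, hn⟩ := (hfin.image Pseudoidentity.arity).bddAbove
  exact not_exists_basis_of_arity_le n E (fun e he => hn ⟨e, he, rfl⟩) hE

theorem mainTheorem2 :
    (IsPseudovariety SMN ∧ pseudovarietyRank SMN = ⊤ ∧ ¬ IsFinitelyBased SMN) ∧
    ∀ (p : ℕ) [Fact p.Prime],
      (gens p).ncard = 2 * p ∧
      (∀ f ∈ gens p, IsPartialBijection f) ∧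
      ¬ SMN (semigroupSp p) ∧
      ∀ x : Fin (2 * p - 1) → semigroupSp p, SMN (Subsemigroup.closure (Set.range x)) := by
  refine ⟨⟨isPseudovariety_SMN, pseudovarietyRank_SMN, not_isFinitelyBased_SMN⟩,
    fun p _ => ⟨ncard_gens, fun f => isPartialBijection_of_mem_gens,
      not_isStronglyMalcevNilpotent_semigroupSp, fun x => ?_⟩⟩
  have := (Fact.out : p.Prime).pos
  exact isStronglyMalcevNilpotent_closure_semigroupSp (by omega) x
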